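/- For a real transcendental number $\zeta$ and an integer $n\ge 1$, let $w_n(\zeta)\in[0,\infty]$ be the supremum of the real $w$ such that $0<|P(\zeta)|\le H(P)^{-w}$ has infinitely many solutions $P\in\mathbb{Z}[T]$ of degree at most $n$, where $H(P)$ is the maximum modulus of the coefficients of $P$. Let $\widehat w_n(\zeta)$ be the supremum of the real $w$ such that for all large $X$ there is $P\in\mathbb{Z}[T]$ of degree at most $n$ with $H(P)\le X$ and $0<|P(\zeta)|\le X^{-w}$. Let $\widehat w^{*}_n(\zeta)$ be the supremum of the real $w$ such that for all large $X$ there is a real algebraic number $\alpha$ of degree at most $n$ with $H(\alpha)\le X$ and $|\zeta-\alpha|\le H(\alpha)^{-1}X^{-w}$, where $H(\alpha)$ is the height of the minimal polynomial of $\alpha$ with coprime integer coefficients. **Theorem.** Let $\zeta$ be a transcendental real number and let $n\ge 2$, $u\ge 1$ be integers. Put $$F_{n,u}(x)=\frac{x^{3}-u x^{2}+(nu+n-1)x-n^{2}}{(x-n)(x-n-u+1)},$$ and let $(\mathrm{E})$ denote the condition $$w_{n+u-1}(\zeta)>w_{n-1}(\zeta)\quad\text{or}\quad \widehat w_n(\zeta)=\widehat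 w_n^{*}(\zeta).$$ 1. If $\widehat w_n^{*}(\zeta)>n+u-1$, then $\widehat w_n^{*}(\zeta)<\infty$ and $w_{n+u}(\zeta)\le F_{n,u}(\widehat w_n^{*}(\zeta))$. 2. If $\widehat w_n(\zeta)>n+u-1$ and $(\mathrm{E})$ holds, then $\widehat w_n(\zeta)<\infty$ and $w_{n+u}(\zeta)\le F_{n,u}(\widehat w_n(\zeta))$. 3. There are effectively computable absolute constants $c,c'>0$ (without loss of generality positive integers), independent of $\zeta,n,u$, with the following property. If either $\delta:=\widehat w_n^{*}(\zeta)-(n+u-1)>0$, or $\delta:=\widehat w_n(\zeta)-(n+u-1)>0$ and $(\mathrm{E})$ holds, then $$w_{n+u}(\zeta)\le c\,\frac{n^{3}}{\delta^{2}},$$ and if moreover $u\ge 2$, then $$w_{n+1}(\zeta)\le c'\,\frac{n^{3}}{\delta}.$$ -/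

import Mathlib

open Filter Polynomial

noncomputable section

/-- Mahler's exponent `w_n(ζ)`: the supremum (possibly `+∞`) of the real numbers `w` such that
`0 < |P(ζ)| ≤ H(P)^(-w)` has infinitely many solutions `P ∈ ℤ[T]` of degree at most `n`. Here the height `H(P)` is the
maximum modulus of the coefficients of `P`, that is `P.supNorm`. -/
def wExp (n : ℕ) (ζ : ℝ) : EReal :=
  sSup ((fun w : ℝ => (w : EReal)) '' {w : ℝ |
    {P : ℤ[X] | P.natDegree ≤ n ∧ 0 < |aeval ζ P| ∧
      |aeval ζ P| ≤ P.supNorm ^ (-w)}.Infinite})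

/-- The uniform exponent `ŵ_n(ζ)`: the supremum of the real numbers `w` such that for all
sufficiently large `X` there is `P ∈ ℤ[T]` of degree at most `n` with `H(P) ≤ X` and
`0 < |P(ζ)| ≤ X^(-w)`. -/
def wHat (n : ℕ) (ζ : ℝ) : EReal :=
  sSup ((fun w : ℝ => (w : EReal)) '' {w : ℝ |
    ∀ᶠ X : ℝ in atTop, ∃ P : ℤ[X], P.natDegree ≤ n ∧ P.supNorm ≤ X ∧
      0 < |aeval ζ P| ∧ |aeval ζ P| ≤ X ^ (-w)})

/-- `P` is a minimal polynomial with coprime integer coefficients of the real algebraic number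
`α`. (An irreducible element of `ℤ[T]` with a root is non-constant, has coprime coefficients
and is irreducible over `ℚ`; it is determined by `α` up to sign.) The degree of `α` is the
degree of `P` and the height `H(α)` is `H(P)`. -/
def IsIntMinpoly (P : ℤ[X]) (α : ℝ) : Prop :=
  Irreducible P ∧ aeval α P = 0

/-- The uniform exponent `ŵ*_n(ζ)`: the supremum of the real numbers `w` such that for all
sufficiently large `X` there is a real algebraic number `α` of degree at most `n` with
`H(α) ≤ X` and `|ζ - α| ≤ H(α)⁻¹ X^(-w)`. -/
def wHatStar (n : ℕ) (ζ : ℝ) : EReal :=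
  sSup ((fun w : ℝ => (w : EReal)) '' {w : ℝ |
    ∀ᶠ X : ℝ in atTop, ∃ (α : ℝ) (P : ℤ[X]), IsIntMinpoly P α ∧ P.natDegree ≤ n ∧
      P.supNorm ≤ X ∧ |ζ - α| ≤ P.supNorm⁻¹ * X ^ (-w)})

/-- The rational function of `x` (standing for `ŵ*_n(ζ)` or `ŵ_n(ζ)`) on the right-hand side
of the bounds. -/
def boundFun (n u : ℕ) (x : ℝ) : ℝ :=
  (x ^ 3 - u * x ^ 2 + (n * u + n - 1) * x - n ^ 2) / ((x - n) * (x - n - u + 1))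

/-- The additional condition `w_{n+u-1}(ζ) > w_{n-1}(ζ)` or `ŵ_n(ζ) = ŵ*_n(ζ)`
(used for `n ≥ 2`, `u ≥ 1` only). -/
def ExtraCond (n u : ℕ) (ζ : ℝ) : Prop :=
  wExp (n - 1) ζ < wExp (n + u - 1) ζ ∨ wHat n ζ = wHatStar n ζ

end

/-!
Let `x` be the uniform exponent in question. An irreducible `P` and a `Q` not divisible by `P` have
a nonzero integer resultant, which the Sylvester matrix bounds by
`H(P)^(deg Q - 1) H(Q)^(deg P) |P(ζ)| + H(P)^(deg Q) H(Q)^(deg P - 1) |Q(ζ)|` up to a constant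
(`exists_one_le_mul_of_not_dvd`). Since the Mahler measure is multiplicative and comparable to the
height, `w_{n+u}(ζ)` is approached by irreducible `P` of arbitrarily large height
(`exists_irreducible_of_infinite`). Such a `P` is confronted with a `Q` of degree at most `n`
provided by the uniform exponent.

* If `deg P > n`, then `P` cannot divide `Q`. Bounding `H(Q)` by a power of `H(P)` slightly above
  `n / (x - n - u + 1)` makes the second term small, so the first one cannot be small, and
  `w_{n+u}(ζ) + 1 ≤ n (x + 1) / (x - n - u + 1)`.
* If `deg P ≤ n`, then `H(Q)` is bounded by `|P(ζ)|^(-1/x)` up to a constant, so that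
  `|Q(ζ)| < |P(ζ)|`. This excludes `P ∣ Q` when `Q` is irreducible, which is the case for `ŵ*_n`, and
  when `deg P = n`, which is the case if `w_{n-1}(ζ) < w_{n+u-1}(ζ)`. The resultant then yields
  `w_{n+u}(ζ) ≤ (n - 1) x / (x - n)`, where `x ≤ 2n - 1` is used (`wHat_le`).

The maximum `sharpBound` of these two bounds is at most `boundFun n u x`, and at most `2 n ^ 2 / δ`
for `x = n + u - 1 + δ`. The latter is stronger than both asymptotic bounds, because `δ ≤ n` and
`w_{n+1}(ζ) ≤ w_{n+u}(ζ)`.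
-/

noncomputable section

/-! ### The resultant inequality -/

namespace Polynomial

lemma one_le_supNorm {P : ℤ[X]} (hP : P ≠ 0) : 1 ≤ P.supNorm := by
  refine le_trans ?_ (P.le_supNorm P.natDegree)
  rw [Int.norm_eq_abs, coeff_natDegree]
  exact_mod_cast Int.one_le_abs (leadingCoeff_ne_zero.mpr hP)

/-- There are only finitely many integer polynomials of bounded degree and height. -/
lemma finite_natDegree_le_supNorm_le (n : ℕ) (B : ℝ) :
    {P : ℤ[X] | P.natDegree ≤ n ∧ P.supNorm ≤ B}.Finite := by
  let f : ℤ[X] → (Fin (n + 1) → ℤ) := fun P i => P.coeff i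
  refine Set.Finite.of_finite_image (f := f) ((Set.Finite.pi' (t := fun _ => Set.Icc (-⌊B⌋) ⌊B⌋)
    fun _ => Set.finite_Icc _ _).subset ?_) ?_
  · rintro _ ⟨P, ⟨-, hB⟩, rfl⟩ i
    have h : |P.coeff i| ≤ ⌊B⌋ := by
      rw [Int.le_floor]
      have := (P.le_supNorm i).trans hB
      rwa [Int.norm_eq_abs, ← Int.cast_abs] at this
    exact abs_le.mp h
  · rintro P ⟨hP, -⟩ Q ⟨hQ, -⟩ h
    ext i
    by_cases hi : i ≤ n
    · exact congrFun h ⟨i, by omega⟩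
    · rw [coeff_eq_zero_of_natDegree_lt (by omega), coeff_eq_zero_of_natDegree_lt (by omega)]

lemma aeval_pos_of_transcendental {ζ : ℝ} (hζ : Transcendental ℚ ζ) {P : ℤ[X]} (hP : P ≠ 0) :
    0 < |aeval ζ P| := by
  rw [abs_pos]
  intro h
  refine hζ ⟨P.map (algebraMap ℤ ℚ), ?_, ?_⟩
  · exact (Polynomial.map_ne_zero_iff (RingHom.injective_int _)).mpr hP
  · rw [aeval_map_algebraMap, h]

end Polynomial

lemma Matrix.abs_det_le_factorial_mul_prod {N : ℕ} (A : Matrix (Fin N) (Fin N) ℝ) (b : Fin N → ℝ)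
    (h : ∀ i j, |A i j| ≤ b j) : |A.det| ≤ N.factorial * ∏ j, b j := by
  rw [Matrix.det_apply]
  refine (Finset.abs_sum_le_sum_abs _ _).trans ?_
  refine (Finset.sum_le_card_nsmul _ _ (∏ j, b j) ?_).trans ?_
  · intro σ _
    rw [Units.smul_def, abs_zsmul, Int.abs_eq_natAbs, Int.units_natAbs, Nat.cast_one, one_smul,
      Finset.abs_prod]
    exact Finset.prod_le_prod (fun _ _ => abs_nonneg _) fun j _ => h _ _
  · simp [Fintype.card_perm]

namespace Polynomial

/-- A column of the Sylvester matrix holds the coefficients of `X ^ j * p`, so pairing it with the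
powers of `ζ` evaluates this polynomial at `ζ`. -/
lemma sum_pow_mul_ite_coeff (p : ℤ[X]) (ζ : ℝ) {N d j : ℕ} (hp : p.natDegree ≤ d)
    (hj : j + d < N) :
    ∑ i : Fin N, ζ ^ (i : ℕ) *
      ((if (i : ℕ) ∈ Set.Icc j (j + d) then p.coeff (i - j) else 0 : ℤ) : ℝ) =
      ζ ^ j * aeval ζ p := by
  have h : aeval ζ (X ^ j * p) = ζ ^ j * aeval ζ p := by simp
  have hdeg : (X ^ j * p).natDegree < N := by
    refine (natDegree_mul_le.trans ?_).trans_lt hj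
    simpa using hp
  rw [← h, aeval_eq_sum_range' hdeg, Finset.sum_range]
  refine Finset.sum_congr rfl fun i _ => ?_
  rw [coeff_X_pow_mul', zsmul_eq_mul, mul_comm]
  congr 2
  by_cases h1 : j ≤ i
  · by_cases h2 : (i : ℕ) ≤ j + d
    · simp [h1, h2]
    · rw [if_neg (by simp [h2]), if_pos h1, coeff_eq_zero_of_natDegree_lt (by omega)]
  · simp [h1]

/-- If the resultant of `P` and `Q` does not vanish, then `P` and `Q` cannot both be very small at
`ζ`: by Cramer's rule the resultant is a combination of the values `ζ ^ j * P(ζ)` and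
`ζ ^ j * Q(ζ)`, whose coefficients are minors of the Sylvester matrix. -/
lemma one_le_of_resultant_ne_zero {P Q : ℤ[X]} (ζ : ℝ) (hP : 0 < P.natDegree) (hQ : Q ≠ 0)
    (h : resultant P Q ≠ 0) :
    1 ≤ (P.natDegree + Q.natDegree).factorial * (P.natDegree + Q.natDegree : ℕ) *
      max 1 |ζ| ^ (P.natDegree + Q.natDegree) *
      (P.supNorm ^ Q.natDegree * Q.supNorm ^ P.natDegree *
        (|aeval ζ P| / P.supNorm + |aeval ζ Q| / Q.supNorm)) := by
  have hP0 : P ≠ 0 := by rintro rfl; simp at hP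
  have hHP := one_le_supNorm hP0
  have hHQ := one_le_supNorm hQ
  set m := P.natDegree with hm
  set n := Q.natDegree with hn
  let A : Matrix (Fin (m + n)) (Fin (m + n)) ℝ := (sylvester P Q m n).map (Int.castRingHom ℝ)
  have hdet : 1 ≤ |A.det| := by
    have : A.det = ((sylvester P Q m n).det : ℝ) := ((Int.castRingHom ℝ).map_det _).symm
    rw [this]
    exact_mod_cast Int.one_le_abs h
  let b : Fin (m + n) → ℝ := Fin.addCases (fun _ => Q.supNorm) (fun _ => P.supNorm)
  have hb0 : ∀ j, 1 ≤ b j := by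
    intro j
    induction j using Fin.addCases <;> simp [b, hHP, hHQ]
  have hA : ∀ i j, |A i j| ≤ b j := by
    have aux (R : ℤ[X]) (c : Prop) [Decidable c] (k : ℕ) (hR : 1 ≤ R.supNorm) :
        |((if c then R.coeff k else 0 : ℤ) : ℝ)| ≤ R.supNorm := by
      split_ifs
      · have := R.le_supNorm k
        rwa [Int.norm_eq_abs] at this
      · simp; linarith
    intro i j
    induction j using Fin.addCases with
    | left j => simpa [A, b, sylvester] using aux Q _ _ hHQ
    | right j => simpa [A, b, sylvester] using aux P _ _ hHP
  have hprod : ∏ j, b j = P.supNorm ^ n * Q.supNorm ^ m := by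
    simp [b, Fin.prod_univ_add, mul_comm]
  let i₀ : Fin (m + n) := ⟨0, by omega⟩
  -- the minors in the expansion of the determinant
  have hadj : ∀ j, |A.adjugate j i₀| ≤ (m + n).factorial * (P.supNorm ^ n * Q.supNorm ^ m / b j) := by
    intro j
    have h1 : A.adjugate j i₀ = (A.updateCol j (Pi.single i₀ 1)).det := by
      rw [← Matrix.cramer_apply, Matrix.cramer_eq_adjugate_mulVec]
      simp
    rw [h1]
    refine (Matrix.abs_det_le_factorial_mul_prod _ (Function.update b j 1) ?_).trans ?_
    · intro i k
      by_cases hk : k = j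
      · subst hk
        by_cases hi : i = i₀ <;> simp [hi]
      · simp [hk, hA]
    · refine mul_le_mul_of_nonneg_left (le_of_eq ?_) (by positivity)
      rw [Finset.prod_update_of_mem (Finset.mem_univ _), one_mul, ← hprod,
        eq_div_iff (by linarith [hb0 j]), mul_comm]
      simpa [Finset.sdiff_singleton_eq_erase] using Finset.mul_prod_erase Finset.univ b (Finset.mem_univ j)
  let z : Fin (m + n) → ℝ := fun i => ζ ^ (i : ℕ)
  let v : Fin (m + n) → ℝ := Matrix.vecMul z A
  have hexp : A.det = ∑ j, v j * A.adjugate j i₀ := by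
    have h1 : Matrix.vecMul v A.adjugate = A.det • z := by
      rw [Matrix.vecMul_vecMul, Matrix.mul_adjugate]
      ext i; simp [Matrix.vecMul_smul]
    have h2 := congrFun h1 i₀
    simpa [Matrix.vecMul, dotProduct, z, i₀] using h2.symm
  set s := |aeval ζ P| / P.supNorm + |aeval ζ Q| / Q.supNorm with hs
  have hpow (j : ℕ) (hj : j ≤ m + n) : |ζ ^ j| ≤ max 1 |ζ| ^ (m + n) := by
    rw [abs_pow]
    exact (pow_le_pow_left₀ (abs_nonneg _) (le_max_right _ _) _).trans
      (pow_le_pow_right₀ (le_max_left _ _) hj)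
  have hv : ∀ j, |v j| / b j ≤ max 1 |ζ| ^ (m + n) * s := by
    intro j
    induction j using Fin.addCases with
    | left j =>
      have : v (Fin.castAdd n j) = ζ ^ (j : ℕ) * aeval ζ Q := by
        rw [← sum_pow_mul_ite_coeff Q ζ (N := m + n) (d := n) le_rfl (by omega)]
        simp [v, z, A, Matrix.vecMul, dotProduct, sylvester]
      rw [this, abs_mul, mul_div_assoc]
      refine mul_le_mul (hpow _ (by omega)) ?_
        (div_nonneg (abs_nonneg _) (zero_le_one.trans (hb0 _))) (by positivity)
      have : 0 ≤ |aeval ζ P| / P.supNorm := by positivity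
      simpa [b, hs] using this
    | right j =>
      have : v (Fin.natAdd m j) = ζ ^ (j : ℕ) * aeval ζ P := by
        rw [← sum_pow_mul_ite_coeff P ζ (N := m + n) (d := m) le_rfl (by omega)]
        simp [v, z, A, Matrix.vecMul, dotProduct, sylvester]
      rw [this, abs_mul, mul_div_assoc]
      refine mul_le_mul (hpow _ (by omega)) ?_
        (div_nonneg (abs_nonneg _) (zero_le_one.trans (hb0 _))) (by positivity)
      have : 0 ≤ |aeval ζ Q| / Q.supNorm := by positivity
      simpa [b, hs] using this
  calc 1 ≤ |A.det| := hdet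
    _ ≤ ∑ j, |v j * A.adjugate j i₀| := by rw [hexp]; exact Finset.abs_sum_le_sum_abs _ _
    _ ≤ ∑ _j : Fin (m + n), max 1 |ζ| ^ (m + n) * s *
          ((m + n).factorial * (P.supNorm ^ n * Q.supNorm ^ m)) := by
        refine Finset.sum_le_sum fun j _ => ?_
        have hbj : 0 < b j := by linarith [hb0 j]
        rw [abs_mul]
        calc |v j| * |A.adjugate j i₀|
            ≤ |v j| * ((m + n).factorial * (P.supNorm ^ n * Q.supNorm ^ m / b j)) := by
              gcongr; exact hadj j
          _ = |v j| / b j * ((m + n).factorial * (P.supNorm ^ n * Q.supNorm ^ m)) := by ring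
          _ ≤ _ := by gcongr; exact hv j
    _ = _ := by
        simp only [Finset.sum_const, Finset.card_univ, Fintype.card_fin, nsmul_eq_mul]
        push_cast
        ring

lemma resultant_ne_zero_of_irreducible {P Q : ℤ[X]} (hP : Irreducible P) (hdeg : 0 < P.natDegree)
    (h : ¬ P ∣ Q) : resultant P Q ≠ 0 := by
  have hprim : P.IsPrimitive := hP.isPrimitive hdeg.ne'
  have hirr : Irreducible (P.map (Int.castRingHom ℚ)) :=
    (IsPrimitive.Int.irreducible_iff_irreducible_map_cast hprim).mp hP
  have hdvd : ¬ P.map (Int.castRingHom ℚ) ∣ Q.map (Int.castRingHom ℚ) := by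
    intro h'
    exact h (hprim.dvd_of_fraction_map_dvd_fraction_map (K := ℚ) h')
  have hcop := (hirr.coprime_iff_not_dvd).mpr hdvd
  have hres := resultant_ne_zero _ _ hcop
  intro h0
  apply hres
  rw [natDegree_map_eq_of_injective (RingHom.injective_int _),
    natDegree_map_eq_of_injective (RingHom.injective_int _), resultant_map_map, h0, map_zero]

/-- The resultant inequality: an irreducible `P` and a nonzero `Q` not divisible by `P` cannot both
be very small at `ζ` with respect to their heights. -/
lemma exists_one_le_mul_of_not_dvd (ζ : ℝ) (p q : ℕ) (hp : 1 ≤ p) :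
    ∃ C : ℝ, 0 < C ∧ ∀ P Q : ℤ[X], Irreducible P → 0 < P.natDegree → P.natDegree ≤ p →
      Q ≠ 0 → Q.natDegree ≤ q → ¬ P ∣ Q → ∀ Y : ℝ, Q.supNorm ≤ Y →
      1 ≤ C * (P.supNorm ^ q * Y ^ p * (|aeval ζ P| / P.supNorm + |aeval ζ Q| / Y)) := by
  refine ⟨(p + q).factorial * (p + q : ℕ) * max 1 |ζ| ^ (p + q), by positivity, ?_⟩
  intro P Q hP hdeg hPp hQ hQq hdvd Y hY
  have hHP := one_le_supNorm hP.ne_zero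
  have hHQ := one_le_supNorm hQ
  refine (one_le_of_resultant_ne_zero ζ hdeg hQ
    (resultant_ne_zero_of_irreducible hP hdeg hdvd)).trans ?_
  have hY1 : 1 ≤ Y := hHQ.trans hY
  have h1 : (1 : ℝ) ≤ max 1 |ζ| := le_max_left _ _
  have h2 : Q.supNorm ^ P.natDegree ≤ Q.supNorm ^ p := pow_le_pow_right₀ hHQ hPp
  -- the factor `Y ^ p / Y` is increasing in `Y` since `p ≥ 1`
  have h3 : Q.supNorm ^ p * (|aeval ζ Q| / Q.supNorm) ≤ Y ^ p * (|aeval ζ Q| / Y) := by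
    obtain ⟨k, rfl⟩ : ∃ k, p = k + 1 := ⟨p - 1, by omega⟩
    have e (t : ℝ) (ht : 1 ≤ t) : t ^ (k + 1) * (|aeval ζ Q| / t) = t ^ k * |aeval ζ Q| := by
      rw [pow_succ]; field_simp
    rw [e _ hHQ, e _ hY1]
    gcongr
  have h4 : Q.supNorm ^ p * (|aeval ζ P| / P.supNorm) ≤ Y ^ p * (|aeval ζ P| / P.supNorm) := by
    gcongr
  refine mul_le_mul ?_ ?_ (by positivity) (by positivity)
  · refine mul_le_mul ?_ (pow_le_pow_right₀ h1 (by omega)) (by positivity) (by positivity)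
    refine mul_le_mul ?_ (by exact_mod_cast (by omega)) (by positivity) (by positivity)
    exact_mod_cast Nat.factorial_le (by omega)
  · calc P.supNorm ^ Q.natDegree * Q.supNorm ^ P.natDegree *
          (|aeval ζ P| / P.supNorm + |aeval ζ Q| / Q.supNorm)
        ≤ P.supNorm ^ q * Q.supNorm ^ p *
          (|aeval ζ P| / P.supNorm + |aeval ζ Q| / Q.supNorm) := by gcongr
      _ = P.supNorm ^ q * (Q.supNorm ^ p * (|aeval ζ P| / P.supNorm) +
          Q.supNorm ^ p * (|aeval ζ Q| / Q.supNorm)) := by ring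
      _ ≤ P.supNorm ^ q * (Y ^ p * (|aeval ζ P| / P.supNorm) + Y ^ p * (|aeval ζ Q| / Y)) := by
          gcongr
      _ = _ := by ring

end Polynomial

/-! ### Irreducible factors and Mahler measure -/

namespace Polynomial

lemma supNorm_map_intCast (P : ℤ[X]) : (P.map (Int.castRingHom ℂ)).supNorm = P.supNorm := by
  simp only [supNorm_eq_iSup, coeff_map, eq_intCast, Complex.norm_intCast, Int.norm_eq_abs]

lemma supNorm_le_two_pow_mul_mahlerMeasure {n : ℕ} {P : ℤ[X]} (hP : P.natDegree ≤ n) :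
    P.supNorm ≤ 2 ^ n * (P.map (Int.castRingHom ℂ)).mahlerMeasure := by
  rw [← supNorm_map_intCast]
  refine (supNorm_le_choose_natDegree_div_two_mul_mahlerMeasure _).trans ?_
  refine mul_le_mul_of_nonneg_right ?_ (mahlerMeasure_nonneg _)
  have h1 : (P.map (Int.castRingHom ℂ)).natDegree ≤ n := natDegree_map_le.trans hP
  have h2 := (Nat.choose_le_two_pow (P.map (Int.castRingHom ℂ)).natDegree
    ((P.map (Int.castRingHom ℂ)).natDegree / 2)).trans (Nat.pow_le_pow_right two_pos h1)
  exact_mod_cast h2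

lemma mahlerMeasure_le_mul_supNorm {n : ℕ} {P : ℤ[X]} (hP : P.natDegree ≤ n) :
    (P.map (Int.castRingHom ℂ)).mahlerMeasure ≤ √(n + 1) * P.supNorm := by
  have h1 : (P.map (Int.castRingHom ℂ)).natDegree ≤ n := natDegree_map_le.trans hP
  have h := mahlerMeasure_le_sqrt_natDegree_add_one_mul_supNorm (P.map (Int.castRingHom ℂ))
  rw [supNorm_map_intCast] at h
  refine h.trans (mul_le_mul_of_nonneg_right ?_ (supNorm_nonneg _))
  gcongr

/-- A weak form of Gelfond's inequality. -/
lemma supNorm_le_mul_supNorm_of_dvd {n : ℕ} {P Q : ℤ[X]} (hQ : Q ≠ 0) (hdeg : Q.natDegree ≤ n)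
    (h : P ∣ Q) : P.supNorm ≤ 2 ^ n * √(n + 1) * Q.supNorm := by
  obtain ⟨R, rfl⟩ := h
  have hR : R ≠ 0 := right_ne_zero_of_mul hQ
  have hP : P.natDegree ≤ n := (natDegree_le_of_dvd (dvd_mul_right P R) hQ).trans hdeg
  have h1 := mahlerMeasure_le_mul_supNorm hdeg
  rw [Polynomial.map_mul, mahlerMeasure_mul] at h1
  have h2 := supNorm_le_two_pow_mul_mahlerMeasure hP
  have h3 : 1 ≤ (R.map (Int.castRingHom ℂ)).mahlerMeasure := one_le_mahlerMeasure_of_ne_zero hR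
  have h4 := mahlerMeasure_nonneg (P.map (Int.castRingHom ℂ))
  calc P.supNorm ≤ 2 ^ n * (P.map (Int.castRingHom ℂ)).mahlerMeasure := h2
    _ ≤ 2 ^ n * (√(n + 1) * (P * R).supNorm) := by
      gcongr
      exact (le_mul_of_one_le_right h4 h3).trans h1
    _ = _ := by ring

end Polynomial

lemma Set.Finite.exists_pos_le_one_forall_le {α : Type*} {S : Set α} (hS : S.Finite) {f : α → ℝ}
    (hf : ∀ x ∈ S, 0 < f x) : ∃ c : ℝ, 0 < c ∧ c ≤ 1 ∧ ∀ x ∈ S, c ≤ f x := by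
  have h1 : ∀ᶠ c : ℝ in nhdsWithin 0 (Set.Ioi 0), ∀ x ∈ S, c ≤ f x := by
    refine (Filter.eventually_all_finite hS).2 fun x hx => ?_
    exact mem_of_superset (Ioo_mem_nhdsGT (hf x hx)) fun c hc => hc.2.le
  obtain ⟨c, h, hc⟩ := (h1.and (Ioc_mem_nhdsGT (zero_lt_one' ℝ))).exists
  exact ⟨c, hc.1, hc.2, h⟩

namespace Polynomial

/-- If all irreducible polynomials of degree at most `N` satisfy a lower bound at `ζ` in terms of
their Mahler measure, so do all polynomials of degree at most `N`. -/
lemma pow_natDegree_mul_le_of_irreducible {ζ c w : ℝ} {N : ℕ} (hc : 0 < c) (hc1 : c ≤ 1)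
    (hw : 0 ≤ w)
    (h : ∀ P : ℤ[X], Irreducible P → P.natDegree ≤ N →
      c * (P.map (Int.castRingHom ℂ)).mahlerMeasure ^ (-w) ≤ |aeval ζ P|)
    (P : ℤ[X]) (hP : P ≠ 0) (hN : P.natDegree ≤ N) :
    c ^ P.natDegree * (P.map (Int.castRingHom ℂ)).mahlerMeasure ^ (-w) ≤ |aeval ζ P| := by
  have hM {Q : ℤ[X]} (hQ : Q ≠ 0) : (Q.map (Int.castRingHom ℂ)).mahlerMeasure ^ (-w) ≤ 1 :=
    Real.rpow_le_one_of_one_le_of_nonpos (one_le_mahlerMeasure_of_ne_zero hQ) (by linarith)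
  have hconst {a : ℤ} (ha : a ≠ 0) : (1 : ℝ) ≤ |aeval ζ (C a)| := by
    simpa using! (by exact_mod_cast Int.one_le_abs ha : (1 : ℝ) ≤ |(a : ℝ)|)
  have hdeg0 {Q : ℤ[X]} (hQ : Q ≠ 0) (hd : Q.natDegree = 0) :
      c ^ Q.natDegree * (Q.map (Int.castRingHom ℂ)).mahlerMeasure ^ (-w) ≤ |aeval ζ Q| := by
    rw [hd, pow_zero, one_mul]
    refine (hM hQ).trans ?_
    obtain ⟨a, rfl⟩ := natDegree_eq_zero.mp hd
    exact hconst (by simpa using hQ)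
  induction P using UniqueFactorizationMonoid.induction_on_prime with
  | h₁ => exact absurd rfl hP
  | h₂ u hu => exact hdeg0 hu.ne_zero (natDegree_eq_zero_of_isUnit hu)
  | h₃ a p ha hp ih =>
    rw [natDegree_mul hp.ne_zero ha] at hN ⊢
    have hMa := mahlerMeasure_nonneg (a.map (Int.castRingHom ℂ))
    have hMp := mahlerMeasure_nonneg (p.map (Int.castRingHom ℂ))
    have key : c ^ p.natDegree * (p.map (Int.castRingHom ℂ)).mahlerMeasure ^ (-w) ≤
        |aeval ζ p| := by
      rcases Nat.eq_zero_or_pos p.natDegree with hd | hd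
      · exact hdeg0 hp.ne_zero hd
      · refine le_trans ?_ (h p hp.irreducible (by omega))
        gcongr
        exact pow_le_of_le_one hc.le hc1 hd.ne'
    rw [Polynomial.map_mul, mahlerMeasure_mul, Real.mul_rpow hMp hMa, map_mul, abs_mul, pow_add]
    calc _ = (c ^ p.natDegree * (p.map (Int.castRingHom ℂ)).mahlerMeasure ^ (-w)) *
          (c ^ a.natDegree * (a.map (Int.castRingHom ℂ)).mahlerMeasure ^ (-w)) := by ring
      _ ≤ _ := mul_le_mul key (ih ha (by omega)) (by positivity) (abs_nonneg _)

/-- Good approximation by polynomials yields, for any smaller exponent, good approximation by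
irreducible polynomials of arbitrarily large height. -/
lemma exists_irreducible_of_infinite {ζ : ℝ} (hζ : Transcendental ℚ ζ) {N : ℕ} {w w' : ℝ}
    (hw' : 0 < w') (hlt : w' < w)
    (hinf : {P : ℤ[X] | P.natDegree ≤ N ∧ 0 < |aeval ζ P| ∧
      |aeval ζ P| ≤ P.supNorm ^ (-w)}.Infinite) (H₀ : ℝ) :
    ∃ P : ℤ[X], Irreducible P ∧ P.natDegree ≤ N ∧ H₀ ≤ P.supNorm ∧
      |aeval ζ P| ≤ P.supNorm ^ (-w') := by
  by_contra! hcon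
  have hfin : {P : ℤ[X] | (P.natDegree ≤ N ∧ P.supNorm ≤ H₀) ∧ P ≠ 0}.Finite :=
    (finite_natDegree_le_supNorm_le N H₀).subset fun P hP => hP.1
  -- the finitely many irreducible polynomials of small height are handled by the constant `c`
  obtain ⟨c, hc, hc1, hcS⟩ := hfin.exists_pos_le_one_forall_le (f := fun P => |aeval ζ P|)
    fun P hP => aeval_pos_of_transcendental hζ hP.2
  set K : ℝ := 2 ^ N with hK
  have hK1 : 1 ≤ K := one_le_pow₀ one_le_two
  have hKw : 0 < K ^ (-w') := by positivity
  have hKw1 : K ^ (-w') ≤ 1 := Real.rpow_le_one_of_one_le_of_nonpos hK1 (by linarith)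
  have hirr : ∀ P : ℤ[X], Irreducible P → P.natDegree ≤ N →
      c * K ^ (-w') * (P.map (Int.castRingHom ℂ)).mahlerMeasure ^ (-w') ≤ |aeval ζ P| := by
    intro P hP hPN
    have hM1 : 1 ≤ (P.map (Int.castRingHom ℂ)).mahlerMeasure :=
      one_le_mahlerMeasure_of_ne_zero hP.ne_zero
    have hH1 := one_le_supNorm hP.ne_zero
    rcases le_total H₀ P.supNorm with hH | hH
    · refine le_trans ?_ (hcon P hP hPN hH).le
      rw [mul_assoc, ← Real.mul_rpow (by positivity) (by positivity)]
      refine (mul_le_of_le_one_left (by positivity) hc1).trans ?_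
      exact Real.rpow_le_rpow_of_nonpos (by positivity)
        (supNorm_le_two_pow_mul_mahlerMeasure hPN) (by linarith)
    · refine le_trans ?_ (hcS P ⟨⟨hPN, hH⟩, hP.ne_zero⟩)
      rw [mul_assoc]
      refine mul_le_of_le_one_right hc.le (mul_le_one₀ hKw1 (by positivity) ?_)
      exact Real.rpow_le_one_of_one_le_of_nonpos hM1 (by linarith)
  set c' := c * K ^ (-w') with hc'
  have hc'0 : 0 < c' := by positivity
  have hc'1 : c' ≤ 1 := mul_le_one₀ hc1 hKw.le hKw1
  set L : ℝ := √(N + 1) with hL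
  have hL0 : 0 < L := by positivity
  refine hinf ((finite_natDegree_le_supNorm_le N
    ((c' ^ N * L ^ (-w'))⁻¹ ^ (w - w')⁻¹)).subset ?_)
  rintro P ⟨hPN, hpos, hle⟩
  refine ⟨hPN, ?_⟩
  have hP : P ≠ 0 := by rintro rfl; simp at hpos
  have hH1 := one_le_supNorm hP
  have hH0 : 0 < P.supNorm := by linarith
  have hM1 : 1 ≤ (P.map (Int.castRingHom ℂ)).mahlerMeasure := one_le_mahlerMeasure_of_ne_zero hP
  have h1 := pow_natDegree_mul_le_of_irreducible hc'0 hc'1 hw'.le hirr P hP hPN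
  have h2 : c' ^ N * L ^ (-w') * P.supNorm ^ (-w') ≤ P.supNorm ^ (-w) := by
    refine le_trans ?_ (h1.trans hle)
    rw [mul_assoc, ← Real.mul_rpow (by positivity) (by positivity)]
    refine mul_le_mul (pow_le_pow_of_le_one hc'0.le hc'1 hPN) ?_ (by positivity) (by positivity)
    exact Real.rpow_le_rpow_of_nonpos (by positivity) (mahlerMeasure_le_mul_supNorm hPN)
      (by linarith)
  have h3 : P.supNorm ^ (w - w') ≤ (c' ^ N * L ^ (-w'))⁻¹ := by
    rw [le_inv_comm₀ (by positivity) (by positivity), ← Real.rpow_neg hH0.le]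
    have e : P.supNorm ^ (-w) = P.supNorm ^ (-(w - w')) * P.supNorm ^ (-w') := by
      rw [← Real.rpow_add hH0]; ring_nf
    rw [e] at h2
    exact le_of_mul_le_mul_right h2 (by positivity)
  calc P.supNorm = (P.supNorm ^ (w - w')) ^ (w - w')⁻¹ := by
        rw [← Real.rpow_mul hH0.le, mul_inv_cancel₀ (by linarith), Real.rpow_one]
    _ ≤ _ := Real.rpow_le_rpow (by positivity) h3 (by simp; linarith)

end Polynomial

/-! ### Confronting two families of polynomials -/

lemma eventually_mul_rpow_lt {C a ε : ℝ} (hε : 0 < ε) (ha : a < 0) :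
    ∀ᶠ H : ℝ in atTop, C * H ^ a < ε := by
  have h := (tendsto_rpow_neg_atTop (y := -a) (by linarith)).const_mul C
  rw [neg_neg, mul_zero] at h
  exact h.eventually (gt_mem_nhds hε)

lemma natDegree_pos_of_abs_aeval_le {ζ w : ℝ} {P : ℤ[X]} (hw : 0 < w) (hH : 1 < P.supNorm)
    (h : |aeval ζ P| ≤ P.supNorm ^ (-w)) : 0 < P.natDegree := by
  by_contra! hd
  obtain ⟨a, rfl⟩ := natDegree_eq_zero.mp (Nat.le_zero.mp hd)
  have h1 := h.trans (Real.rpow_le_one_of_one_le_of_nonpos hH.le (by linarith))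
  rw [supNorm_C, Int.norm_eq_abs] at hH
  simp at h1
  linarith

/-- A resultant argument: `Q` is chosen of height at most `H(P) ^ t`, and it is assumed that this
`Q` is not divisible by `P`. -/
lemma false_of_approx_of_not_dvd {ζ : ℝ} {p q : ℕ} (hp : 1 ≤ p) {x w t : ℝ} (ht : 0 < t)
    (hw : 0 < w) (h1 : q + t * (p - 1 - x) < 0) (h2 : q - 1 + t * p - w < 0)
    (hQ : ∀ᶠ X : ℝ in atTop, ∃ Q : ℤ[X], Q.natDegree ≤ q ∧ Q.supNorm ≤ X ∧
      0 < |aeval ζ Q| ∧ |aeval ζ Q| ≤ X ^ (-x))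
    (hP : ∀ H₀ : ℝ, ∃ P : ℤ[X], Irreducible P ∧ P.natDegree ≤ p ∧ H₀ ≤ P.supNorm ∧
      |aeval ζ P| ≤ P.supNorm ^ (-w) ∧
      ∀ Q : ℤ[X], Q ≠ 0 → Q.natDegree ≤ q → Q.supNorm ≤ P.supNorm ^ t → ¬ P ∣ Q) :
    False := by
  obtain ⟨C, hC, hres⟩ := exists_one_le_mul_of_not_dvd ζ p q hp
  obtain ⟨H₀, hH₀⟩ := eventually_atTop.mp (((eventually_mul_rpow_lt (C := C) one_half_pos h1).and
    (eventually_mul_rpow_lt (C := C) one_half_pos h2)).and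
    (((tendsto_rpow_atTop ht).eventually hQ).and (eventually_gt_atTop 1)))
  obtain ⟨P, hirr, hPp, hPH, hPζ, hdvd⟩ := hP H₀
  obtain ⟨⟨hb1, hb2⟩, ⟨Q, hQq, hQX, hQ0, hQζ⟩, hH1⟩ := hH₀ _ hPH
  set H := P.supNorm with hH
  have hHpos : 0 < H := by linarith
  have hQne : Q ≠ 0 := by rintro rfl; simp at hQ0
  have hmain := hres P Q hirr (natDegree_pos_of_abs_aeval_le hw hH1 hPζ) hPp hQne hQq
    (hdvd Q hQne hQq hQX) _ hQX
  have e1 : H ^ q * (H ^ t) ^ p * (H ^ (-w) / H) = H ^ (q - 1 + t * p - w) := by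
    rw [← Real.rpow_natCast, ← Real.rpow_natCast, ← Real.rpow_mul hHpos.le, ← Real.rpow_add hHpos,
      ← Real.rpow_sub_one hHpos.ne', ← Real.rpow_add hHpos]
    ring_nf
  have e2 : H ^ q * (H ^ t) ^ p * ((H ^ t) ^ (-x) / H ^ t) = H ^ (q + t * (p - 1 - x)) := by
    rw [← Real.rpow_natCast, ← Real.rpow_natCast, ← Real.rpow_mul hHpos.le, ← Real.rpow_add hHpos,
      ← Real.rpow_mul hHpos.le, ← Real.rpow_sub hHpos, ← Real.rpow_add hHpos]
    ring_nf
  have : C * (H ^ q * (H ^ t) ^ p * (|aeval ζ P| / H + |aeval ζ Q| / H ^ t)) ≤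
      C * (H ^ q * (H ^ t) ^ p * (H ^ (-w) / H + (H ^ t) ^ (-x) / H ^ t)) := by
    gcongr
  rw [mul_add _ (H ^ (-w) / H), e1, e2, mul_add C] at this
  linarith

/-- A resultant argument: the bound on the height of `Q` is chosen such that `|Q(ζ)| < |P(ζ)|`,
which forces `Q` not to be divisible by `P`. -/
lemma false_of_approx_of_le {ζ : ℝ} {p q : ℕ} (hp : 1 ≤ p) (hq : 1 ≤ q) {x w : ℝ}
    (hx : 0 < x) (hw : 0 < w) (h1 : (q - 1) / w + p / x < 1) (h2 : q / w + (p - 1) / x < 1)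
    {adm : ℤ[X] → Prop}
    (hQ : ∀ᶠ X : ℝ in atTop, ∃ Q : ℤ[X], Q.natDegree ≤ q ∧ Q.supNorm ≤ X ∧
      0 < |aeval ζ Q| ∧ |aeval ζ Q| ≤ X ^ (-x) ∧ adm Q)
    (hP : ∀ H₀ : ℝ, ∃ P : ℤ[X], Irreducible P ∧ P.natDegree ≤ p ∧ H₀ ≤ P.supNorm ∧
      0 < |aeval ζ P| ∧ |aeval ζ P| ≤ P.supNorm ^ (-w) ∧
      ∀ Q : ℤ[X], Q ≠ 0 → adm Q → Q.natDegree ≤ q → P ∣ Q → |aeval ζ P| ≤ |aeval ζ Q|) :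
    False := by
  obtain ⟨C, hC, hres⟩ := exists_one_le_mul_of_not_dvd ζ p q hp
  have ev : ∀ᶠ Z : ℝ in atTop, (C * 2 * Z ^ ((q - 1) / w + p / x - 1) < 1 / 2 ∧
      C * Z ^ (q / w + (p - 1) / x - 1) < 1 / 2) ∧
      (∃ Q : ℤ[X], Q.natDegree ≤ q ∧ Q.supNorm ≤ Z ^ x⁻¹ ∧
        0 < |aeval ζ Q| ∧ |aeval ζ Q| ≤ (Z ^ x⁻¹) ^ (-x) ∧ adm Q) :=
    ((eventually_mul_rpow_lt one_half_pos (by linarith)).and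
      (eventually_mul_rpow_lt one_half_pos (by linarith))).and
      ((tendsto_rpow_atTop (inv_pos.mpr hx)).eventually hQ)
  obtain ⟨Z₀, hZ₀⟩ := eventually_atTop.mp ev
  obtain ⟨H₀, hH₀⟩ := eventually_atTop.mp
    (((tendsto_rpow_atTop hw).eventually (eventually_ge_atTop Z₀)).and (eventually_gt_atTop 1))
  obtain ⟨P, hirr, hPp, hPH, hP0, hPζ, hdvd⟩ := hP H₀
  obtain ⟨hHw, hH1⟩ := hH₀ _ hPH
  set H := P.supNorm with hH
  have hHpos : 0 < H := by linarith
  -- the bound `Z ^ (1 / x)` on the height of `Q` makes `|Q(ζ)| ≤ Z⁻¹ = |P(ζ)| / 2`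
  obtain ⟨Z, hZ⟩ : ∃ Z, Z = 2 / |aeval ζ P| := ⟨_, rfl⟩
  have hZpos : 0 < Z := by rw [hZ]; positivity
  have hPZ : |aeval ζ P| = 2 * Z⁻¹ := by rw [hZ]; field_simp
  have hHZ : H ^ w ≤ Z := by
    rw [Real.rpow_neg hHpos.le] at hPζ
    have h3 : H ^ w ≤ |aeval ζ P|⁻¹ := (le_inv_comm₀ hP0 (by positivity)).mp hPζ
    have h4 : 0 < |aeval ζ P|⁻¹ := inv_pos.mpr hP0
    rw [hZ, div_eq_mul_inv]
    linarith
  have hHZ' : H ≤ Z ^ w⁻¹ := by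
    calc H = (H ^ w) ^ w⁻¹ := by
          rw [← Real.rpow_mul hHpos.le, mul_inv_cancel₀ hw.ne', Real.rpow_one]
      _ ≤ Z ^ w⁻¹ := Real.rpow_le_rpow (by positivity) hHZ (by positivity)
  obtain ⟨⟨hb1, hb2⟩, Q, hQq, hQX, hQ0, hQζ, hadm⟩ := hZ₀ Z (hHw.trans hHZ)
  have hQne : Q ≠ 0 := by rintro rfl; simp at hQ0
  rw [← Real.rpow_mul hZpos.le, mul_neg, inv_mul_cancel₀ hx.ne', Real.rpow_neg_one] at hQζ
  have hZinv : 0 < Z⁻¹ := inv_pos.mpr hZpos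
  have hnd : ¬ P ∣ Q := fun h => by
    have := hdvd Q hQne hadm hQq h
    linarith
  have hmain := hres P Q hirr (natDegree_pos_of_abs_aeval_le hw hH1 hPζ) hPp hQne hQq hnd _ hQX
  have e1 : H ^ q * (Z ^ x⁻¹) ^ p * (|aeval ζ P| / H) ≤
      2 * Z ^ ((q - 1) / w + p / x - 1) := by
    have h3 : H ^ q / H ≤ Z ^ ((q - 1) / w) := by
      rw [← Real.rpow_natCast, ← Real.rpow_sub_one hHpos.ne', div_eq_inv_mul,
        Real.rpow_mul hZpos.le]
      have : (1 : ℝ) ≤ q := by exact_mod_cast hq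
      exact Real.rpow_le_rpow hHpos.le hHZ' (by linarith)
    have h4 : (Z ^ x⁻¹) ^ p = Z ^ (p / x) := by
      rw [← Real.rpow_natCast, ← Real.rpow_mul hZpos.le]; ring_nf
    rw [hPZ, h4, Real.rpow_sub_one hZpos.ne', Real.rpow_add hZpos]
    calc H ^ q * Z ^ (p / x) * (2 * Z⁻¹ / H) = H ^ q / H * (Z ^ (p / x) * (2 * Z⁻¹)) := by ring
      _ ≤ Z ^ ((q - 1) / w) * (Z ^ (p / x) * (2 * Z⁻¹)) := by gcongr
      _ = _ := by ring
  have e2 : H ^ q * (Z ^ x⁻¹) ^ p * (|aeval ζ Q| / Z ^ x⁻¹) ≤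
      Z ^ (q / w + (p - 1) / x - 1) := by
    have h3 : H ^ q ≤ Z ^ (q / w) := by
      rw [← Real.rpow_natCast, div_eq_inv_mul, Real.rpow_mul hZpos.le]
      exact Real.rpow_le_rpow hHpos.le hHZ' (by positivity)
    have h4 : (Z ^ x⁻¹) ^ p / Z ^ x⁻¹ = Z ^ ((p - 1) / x) := by
      rw [← Real.rpow_natCast, ← Real.rpow_mul hZpos.le, ← Real.rpow_sub hZpos]; ring_nf
    rw [Real.rpow_sub_one hZpos.ne', Real.rpow_add hZpos, ← h4]
    calc H ^ q * (Z ^ x⁻¹) ^ p * (|aeval ζ Q| / Z ^ x⁻¹)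
        = H ^ q * ((Z ^ x⁻¹) ^ p / Z ^ x⁻¹ * |aeval ζ Q|) := by ring
      _ ≤ Z ^ (q / w) * ((Z ^ x⁻¹) ^ p / Z ^ x⁻¹ * Z⁻¹) := by gcongr
      _ = _ := by ring
  rw [mul_add] at hmain
  have := hmain.trans (mul_le_mul_of_nonneg_left (add_le_add e1 e2) hC.le)
  linarith

/-- The two resultant arguments combined. The first bound on `w` excludes infinitely many `P` of
degree greater than `n`, the other two exclude infinitely many `P` of degree at most `n`. -/
lemma false_of_irreducible_approx {ζ : ℝ} {n u : ℕ} (hn : 1 ≤ n) {x w : ℝ}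
    (hx : n + u - 1 < x) (hw : 0 < w) (h0 : n * (x + 1) < (w + 1) * (x - n - u + 1))
    (h1 : (n - 1) * x < w * (x - n)) (h2 : n * x < w * (x - n + 1)) (hx0 : 0 < x)
    {adm : ℤ[X] → Prop}
    (hQ : ∀ᶠ X : ℝ in atTop, ∃ Q : ℤ[X], Q.natDegree ≤ n ∧ Q.supNorm ≤ X ∧
      0 < |aeval ζ Q| ∧ |aeval ζ Q| ≤ X ^ (-x) ∧ adm Q)
    (hP : ∀ H₀ : ℝ, ∃ P : ℤ[X], Irreducible P ∧ P.natDegree ≤ n + u ∧ H₀ ≤ P.supNorm ∧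
      0 < |aeval ζ P| ∧ |aeval ζ P| ≤ P.supNorm ^ (-w) ∧
      ∀ Q : ℤ[X], Q ≠ 0 → adm Q → Q.natDegree ≤ n → P ∣ Q → |aeval ζ P| ≤ |aeval ζ Q|) :
    False := by
  have hn1 : (1 : ℝ) ≤ n := by exact_mod_cast hn
  have hu0 : (0 : ℝ) ≤ u := u.cast_nonneg
  by_cases hA : ∀ H₀ : ℝ, ∃ P : ℤ[X], Irreducible P ∧ P.natDegree ≤ n + u ∧ H₀ ≤ P.supNorm ∧
      |aeval ζ P| ≤ P.supNorm ^ (-w) ∧ n < P.natDegree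
  · -- the two terms of the resultant inequality give a lower and an upper bound for `t`
    obtain ⟨t, ht1, ht2⟩ : ∃ t : ℝ, n / (x - n - u + 1) < t ∧ t < (w - n + 1) / (n + u) := by
      refine exists_between ?_
      rw [div_lt_div_iff₀ (by linarith) (by linarith)]
      linarith
    have hB : 0 < x - n - u + 1 := by linarith
    have ht : 0 < t := lt_trans (by positivity) ht1
    rw [div_lt_iff₀ hB] at ht1
    rw [lt_div_iff₀ (by linarith)] at ht2
    refine false_of_approx_of_not_dvd (ζ := ζ) (p := n + u) (q := n) (x := x) (w := w) (by omega)
      ht hw (by push_cast; linarith) (by push_cast; linarith) ?_ ?_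
    · filter_upwards [hQ] with X ⟨Q, hQ1, hQ2, hQ3, hQ4, _⟩ using ⟨Q, hQ1, hQ2, hQ3, hQ4⟩
    · intro H₀
      obtain ⟨P, hP1, hP2, hP3, hP4, hP5⟩ := hA H₀
      exact ⟨P, hP1, hP2, hP3, hP4, fun Q hQ0 hQn _ hdvd =>
        absurd (natDegree_le_of_dvd hdvd hQ0) (by omega)⟩
  · push Not at hA
    obtain ⟨H₁, hH₁⟩ := hA
    refine false_of_approx_of_le (ζ := ζ) (p := n) (q := n) (x := x) (w := w) hn hn hx0 hw ?_ ?_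
      hQ ?_
    · rw [div_add_div _ _ hw.ne' hx0.ne', div_lt_one (by positivity)]
      linarith
    · rw [div_add_div _ _ hw.ne' hx0.ne', div_lt_one (by positivity)]
      linarith
    · intro H₀
      obtain ⟨P, hP1, hP2, hP3, hP4, hP5, hP6⟩ := hP (max H₀ H₁)
      exact ⟨P, hP1, hH₁ P hP1 hP2 ((le_max_right _ _).trans hP3) hP5,
        (le_max_left _ _).trans hP3, hP4, hP5, hP6⟩

/-! ### Exponents of approximation -/

/-- At every large height `X` there is an admissible integer polynomial of degree at most `n` whose
value at `ζ` is nonzero and at most `X ^ (-x)`. -/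
def UniformApprox (adm : ℤ[X] → Prop) (n : ℕ) (ζ x : ℝ) : Prop :=
  ∀ᶠ X : ℝ in atTop, ∃ Q : ℤ[X], Q.natDegree ≤ n ∧ Q.supNorm ≤ X ∧
    0 < |aeval ζ Q| ∧ |aeval ζ Q| ≤ X ^ (-x) ∧ adm Q

lemma lt_wExp_iff {N : ℕ} {ζ w : ℝ} : (w : EReal) < wExp N ζ ↔ ∃ w' : ℝ, w < w' ∧
    {P : ℤ[X] | P.natDegree ≤ N ∧ 0 < |aeval ζ P| ∧
      |aeval ζ P| ≤ P.supNorm ^ (-w')}.Infinite := by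
  simp only [wExp, lt_sSup_iff, Set.exists_mem_image, EReal.coe_lt_coe_iff, Set.mem_ofPred_eq]
  exact exists_congr fun _ => and_comm

lemma wExp_mono {M N : ℕ} (h : M ≤ N) (ζ : ℝ) : wExp M ζ ≤ wExp N ζ := by
  refine sSup_le_sSup (Set.image_mono fun w hw => ?_)
  exact Set.Infinite.mono (fun P hP => ⟨hP.1.trans h, hP.2⟩) hw

lemma exists_irreducible_of_lt_wExp {ζ : ℝ} (hζ : Transcendental ℚ ζ) {N : ℕ} {w : ℝ}
    (hw : 0 < w) (h : (w : EReal) < wExp N ζ) (H₀ : ℝ) :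
    ∃ P : ℤ[X], Irreducible P ∧ P.natDegree ≤ N ∧ H₀ ≤ P.supNorm ∧
      |aeval ζ P| ≤ P.supNorm ^ (-w) := by
  obtain ⟨w', hlt, hinf⟩ := lt_wExp_iff.mp h
  exact exists_irreducible_of_infinite hζ hw hlt hinf H₀

/-- Beyond a certain height, an approximation of quality `w > w_M(ζ)` has degree exceeding `M`. -/
lemma exists_forall_lt_natDegree_of_wExp_lt {ζ : ℝ} (hζ : Transcendental ℚ ζ) {M : ℕ} {w : ℝ}
    (h : wExp M ζ < w) :
    ∃ H₁ : ℝ, ∀ P : ℤ[X], P ≠ 0 → H₁ < P.supNorm → |aeval ζ P| ≤ P.supNorm ^ (-w) →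
      M < P.natDegree := by
  have hfin : {P : ℤ[X] | P.natDegree ≤ M ∧ 0 < |aeval ζ P| ∧
      |aeval ζ P| ≤ P.supNorm ^ (-w)}.Finite := by
    by_contra hinf
    exact h.not_ge (le_sSup ⟨w, hinf, rfl⟩)
  obtain ⟨H₁, hH₁⟩ := (hfin.image supNorm).bddAbove
  refine ⟨H₁, fun P hP hH hPζ => ?_⟩
  by_contra! hd
  exact hH.not_ge (hH₁ ⟨P, ⟨hd, aeval_pos_of_transcendental hζ hP, hPζ⟩, rfl⟩)

lemma UniformApprox.mono {adm adm' : ℤ[X] → Prop} {n : ℕ} {ζ x x' : ℝ}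
    (h : UniformApprox adm n ζ x) (hx : x' ≤ x) (ha : ∀ Q, adm Q → adm' Q) :
    UniformApprox adm' n ζ x' := by
  filter_upwards [h, eventually_ge_atTop 1] with X ⟨Q, h1, h2, h3, h4, h5⟩ hX
  exact ⟨Q, h1, h2, h3, h4.trans (Real.rpow_le_rpow_of_exponent_le hX (by linarith)), ha Q h5⟩

lemma uniformApprox_of_lt_wHat {n : ℕ} {ζ x : ℝ} (h : (x : EReal) < wHat n ζ) :
    UniformApprox (fun _ => True) n ζ x := by
  simp only [wHat, lt_sSup_iff, Set.exists_mem_image, EReal.coe_lt_coe_iff,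
    Set.mem_ofPred_eq] at h
  obtain ⟨w, hw, hxw⟩ := h
  refine UniformApprox.mono (x := w) (adm := fun _ => True) ?_ hxw.le (fun _ h => h)
  filter_upwards [hw] with X ⟨Q, h1, h2, h3, h4⟩ using ⟨Q, h1, h2, h3, h4, trivial⟩

lemma UniformApprox.le_wHat {adm : ℤ[X] → Prop} {n : ℕ} {ζ x : ℝ}
    (h : UniformApprox adm n ζ x) : (x : EReal) ≤ wHat n ζ := by
  refine le_sSup ⟨x, ?_, rfl⟩
  filter_upwards [h] with X ⟨Q, h1, h2, h3, h4, _⟩ using ⟨Q, h1, h2, h3, h4⟩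

/-- A polynomial with a root near `ζ` is small at `ζ`. -/
lemma abs_aeval_le_of_root {ζ α : ℝ} {n : ℕ} {P : ℤ[X]} (hP : P.natDegree ≤ n)
    (hα : aeval α P = 0) (h : |ζ - α| ≤ 1) :
    |aeval ζ P| ≤ (n + 1 : ℕ) * (n * (|ζ| + 1) ^ n) * P.supNorm * |ζ - α| := by
  have hα1 : |α| ≤ |ζ| + 1 := by
    have := abs_sub_abs_le_abs_sub α ζ
    rw [abs_sub_comm] at this
    linarith
  have h1 : aeval ζ P = ∑ i ∈ Finset.range (n + 1), (P.coeff i : ℝ) * (ζ ^ i - α ^ i) := by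
    have e : aeval ζ P = aeval ζ P - aeval α P := by rw [hα, sub_zero]
    rw [e, aeval_eq_sum_range' (Nat.lt_succ_of_le hP), aeval_eq_sum_range' (Nat.lt_succ_of_le hP),
      ← Finset.sum_sub_distrib]
    refine Finset.sum_congr rfl fun i _ => ?_
    rw [zsmul_eq_mul, zsmul_eq_mul, mul_sub]
  have hone : 1 ≤ |ζ| + 1 := by linarith [abs_nonneg ζ]
  rw [h1]
  refine (Finset.abs_sum_le_sum_abs _ _).trans ((Finset.sum_le_card_nsmul _ _
    (P.supNorm * (|ζ - α| * (n * (|ζ| + 1) ^ n))) ?_).trans (le_of_eq ?_))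
  · intro i hi
    rw [abs_mul]
    refine mul_le_mul ?_ ?_ (abs_nonneg _) (supNorm_nonneg _)
    · have := P.le_supNorm i
      rwa [Int.norm_eq_abs] at this
    · refine (abs_pow_sub_pow_le ζ α i).trans ?_
      rw [mul_assoc]
      have hi' : i ≤ n := by simpa [Nat.lt_succ_iff] using hi
      have hmax : max |ζ| |α| ≤ |ζ| + 1 := max_le (by linarith) hα1
      have h0 : 0 ≤ max |ζ| |α| := le_max_of_le_left (abs_nonneg _)
      have : max |ζ| |α| ^ (i - 1) ≤ (|ζ| + 1) ^ n :=
        (pow_le_pow_left₀ h0 hmax _).trans (pow_le_pow_right₀ hone (by omega))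
      gcongr
  · rw [Finset.card_range, nsmul_eq_mul]; ring

/-- Uniform approximation by algebraic numbers yields uniform approximation by irreducible
polynomials. -/
lemma uniformApprox_irreducible_of_lt_wHatStar {n : ℕ} {ζ x : ℝ} (hζ : Transcendental ℚ ζ)
    (hx : 0 ≤ x) (h : (x : EReal) < wHatStar n ζ) : UniformApprox Irreducible n ζ x := by
  simp only [wHatStar, lt_sSup_iff, Set.exists_mem_image, EReal.coe_lt_coe_iff,
    Set.mem_ofPred_eq] at h
  obtain ⟨w, hw, hxw⟩ := h
  filter_upwards [hw, eventually_ge_atTop 1, eventually_mul_rpow_lt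
    (C := (n + 1 : ℕ) * (n * (|ζ| + 1) ^ n)) (a := x - w) one_pos (by linarith)]
    with X ⟨α, P, ⟨hirr, hroot⟩, hdeg, hX, hα⟩ hX1 hC
  have hH := one_le_supNorm hirr.ne_zero
  have hX0 : 0 < X := by linarith
  have hXw : X ^ (-w) ≤ 1 := Real.rpow_le_one_of_one_le_of_nonpos hX1 (by linarith)
  have hα1 : |ζ - α| ≤ 1 := hα.trans
    (mul_le_one₀ (inv_le_one_of_one_le₀ hH) (by positivity) hXw)
  refine ⟨P, hdeg, hX, aeval_pos_of_transcendental hζ hirr.ne_zero, ?_, hirr⟩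
  have h1 := abs_aeval_le_of_root hdeg hroot hα1
  set D : ℝ := (n + 1 : ℕ) * (n * (|ζ| + 1) ^ n) with hD
  have hD0 : 0 ≤ D := by positivity
  calc |aeval ζ P| ≤ D * P.supNorm * |ζ - α| := h1
    _ ≤ D * P.supNorm * (P.supNorm⁻¹ * X ^ (-w)) := by gcongr
    _ = D * X ^ (-w) := by field_simp
    _ = D * X ^ (x - w) * X ^ (-x) := by
      rw [mul_assoc D, ← Real.rpow_add hX0, show x - w + -x = -w by ring]
    _ ≤ 1 * X ^ (-x) := by gcongr
    _ = X ^ (-x) := one_mul _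

lemma UniformApprox.infinite {adm : ℤ[X] → Prop} {n : ℕ} {ζ x : ℝ}
    (h : UniformApprox adm n ζ x) (hx : 0 < x) :
    {P : ℤ[X] | P.natDegree ≤ n ∧ 0 < |aeval ζ P| ∧
      |aeval ζ P| ≤ P.supNorm ^ (-x)}.Infinite := by
  intro hfin
  obtain ⟨c, hc, -, hcS⟩ := hfin.exists_pos_le_one_forall_le (f := fun P => |aeval ζ P|)
    fun P hP => hP.2.1
  obtain ⟨X, ⟨Q, h1, h2, h3, h4, -⟩, hX⟩ := (h.and
    (eventually_mul_rpow_lt (C := 1) hc (neg_neg_of_pos hx))).exists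
  have hQ : Q ≠ 0 := by rintro rfl; simp at h3
  have h5 : X ^ (-x) ≤ Q.supNorm ^ (-x) := Real.rpow_le_rpow_of_nonpos
    (by linarith [one_le_supNorm hQ]) h2 (by linarith)
  have := hcS Q ⟨h1, h3, h4.trans h5⟩
  linarith

/-! ### Finiteness of the uniform exponents -/

/-- The bound `ŵ_n(ζ) ≤ 2n - 1` of Davenport and Schmidt. If it fails, an irreducible `P` with
`|P(ζ)| ≤ H(P) ^ (-w)`, `w > 2n - 1`, is too small to be coprime to a polynomial `Q` of height
slightly below `H(P)`, which by Gelfond's inequality it does not divide. -/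
lemma wHat_le {n : ℕ} (hn : 1 ≤ n) {ζ : ℝ} (hζ : Transcendental ℚ ζ) :
    wHat n ζ ≤ ((2 * n - 1 : ℝ) : EReal) := by
  by_contra! hlt
  have hn1 : (1 : ℝ) ≤ n := by exact_mod_cast hn
  obtain ⟨x, hx, hxw⟩ := EReal.lt_iff_exists_real_btwn.mp hlt
  rw [EReal.coe_lt_coe_iff] at hx
  have hQ := uniformApprox_of_lt_wHat hxw
  obtain ⟨w, hw, hwx⟩ := exists_between hx
  have hw0 : 0 < w := by linarith
  obtain ⟨t, ⟨ht1, ht2⟩, ht0, ht3⟩ : ∃ t : ℝ, ((n : ℝ) + t * (n - 1 - x) < 0 ∧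
      (n : ℝ) - 1 + t * n - w < 0) ∧ 0 < t ∧ t < 1 := by
    have c1 : ContinuousAt (fun t : ℝ => (n : ℝ) + t * (n - 1 - x)) 1 := by fun_prop
    have c2 : ContinuousAt (fun t : ℝ => (n : ℝ) - 1 + t * n - w) 1 := by fun_prop
    have e1 := c1.eventually (gt_mem_nhds (a := (0 : ℝ)) (by linarith))
    have e2 := c2.eventually (gt_mem_nhds (a := (0 : ℝ)) (by linarith))
    exact (((e1.and e2).filter_mono nhdsWithin_le_nhds).and
      (Ioo_mem_nhdsLT (zero_lt_one' ℝ))).exists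
  refine false_of_approx_of_not_dvd (ζ := ζ) hn ht0 hw0 ht1 ht2 ?_ ?_
  · filter_upwards [hQ] with X ⟨Q, h1, h2, h3, h4, _⟩ using ⟨Q, h1, h2, h3, h4⟩
  · intro H₀
    set K : ℝ := 2 ^ n * √(n + 1) with hK
    obtain ⟨H₁, hH₁⟩ := eventually_atTop.mp ((tendsto_rpow_atTop (y := 1 - t)
      (by linarith)).eventually (eventually_gt_atTop K))
    obtain ⟨P, hP1, hP2, hP3, hP4⟩ := exists_irreducible_of_infinite hζ hw0 hwx
      (hQ.infinite (by linarith)) (max H₀ H₁)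
    refine ⟨P, hP1, hP2, (le_max_left _ _).trans hP3, hP4, fun Q hQ0 hQn hQH hdvd => ?_⟩
    have h1 := hH₁ _ ((le_max_right _ _).trans hP3)
    have hHpos : 0 < P.supNorm := by linarith [one_le_supNorm hP1.ne_zero]
    have h2 : P.supNorm ≤ K * P.supNorm ^ t :=
      (supNorm_le_mul_supNorm_of_dvd hQ0 hQn hdvd).trans (by gcongr)
    have h3 : P.supNorm = P.supNorm ^ (1 - t) * P.supNorm ^ t := by
      rw [← Real.rpow_add hHpos, sub_add_cancel, Real.rpow_one]
    have h4 : K * P.supNorm ^ t < P.supNorm ^ (1 - t) * P.supNorm ^ t := by gcongr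
    linarith

lemma wHatStar_le {n : ℕ} (hn : 1 ≤ n) {ζ : ℝ} (hζ : Transcendental ℚ ζ) :
    wHatStar n ζ ≤ ((2 * n - 1 : ℝ) : EReal) := by
  by_contra! hlt
  have hn1 : (1 : ℝ) ≤ n := by exact_mod_cast hn
  obtain ⟨x, hx, hxw⟩ := EReal.lt_iff_exists_real_btwn.mp hlt
  have hx' : (2 * n - 1 : ℝ) < x := by exact_mod_cast hx
  exact hx.not_ge ((uniformApprox_irreducible_of_lt_wHatStar hζ (by linarith) hxw).le_wHat.trans
    (wHat_le hn hζ))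

/-! ### The bound for `w_{n+u}` -/

/-- The bound for `w_{n+u}(ζ)` that the argument yields when a uniform exponent of order `n`
equals `x > n + u - 1`: the first entry takes care of polynomials of degree at most `n`, the second
one of polynomials of degree between `n + 1` and `n + u`. -/
def sharpBound (n u : ℕ) (x : ℝ) : ℝ :=
  max ((n - 1) * x / (x - n)) (n * (x + 1) / (x - n - u + 1) - 1)

/-- A nonzero multiple of `P` of degree at most `deg P` is a nonzero integer times `P`. -/
lemma abs_aeval_le_of_dvd_of_natDegree_le {ζ : ℝ} {P Q : ℤ[X]} (hQ : Q ≠ 0) (h : P ∣ Q)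
    (hdeg : Q.natDegree ≤ P.natDegree) : |aeval ζ P| ≤ |aeval ζ Q| := by
  obtain ⟨R, rfl⟩ := h
  have hP0 := left_ne_zero_of_mul hQ
  have hR0 := right_ne_zero_of_mul hQ
  rw [natDegree_mul hP0 hR0] at hdeg
  obtain ⟨a, rfl⟩ := natDegree_eq_zero.mp (show R.natDegree = 0 by omega)
  have ha : a ≠ 0 := by simpa using hR0
  rw [map_mul, abs_mul]
  refine le_mul_of_one_le_right (abs_nonneg _) ?_
  simpa using! (by exact_mod_cast Int.one_le_abs ha : (1 : ℝ) ≤ |(a : ℝ)|)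

/-- The resultant arguments need room in the exponent; they are applied to some `y < x` close to
`x`. The bound `x ≤ 2n - 1` makes `(n - 1)x / (x - n)` at least `nx / (x - n + 1)`, which is the
third bound on `w` in `false_of_irreducible_approx`. -/
lemma wExp_le_sharpBound_of {ζ : ℝ} {n u : ℕ} (hn : 1 ≤ n) (hu : 1 ≤ u) {x : ℝ}
    (hx : n + u - 1 < x) (hx2 : x ≤ 2 * n - 1) {adm : ℤ[X] → Prop}
    (hQ : ∀ x' : ℝ, 0 < x' → x' < x → UniformApprox adm n ζ x') {w : ℝ} (hw : 0 < w)
    (hwx : sharpBound n u x < w)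
    (hP : ∀ H₀ : ℝ, ∃ P : ℤ[X], Irreducible P ∧ P.natDegree ≤ n + u ∧ H₀ ≤ P.supNorm ∧
      0 < |aeval ζ P| ∧ |aeval ζ P| ≤ P.supNorm ^ (-w) ∧
      ∀ Q : ℤ[X], Q ≠ 0 → adm Q → Q.natDegree ≤ n → P ∣ Q → |aeval ζ P| ≤ |aeval ζ Q|) :
    False := by
  have hn1 : (1 : ℝ) ≤ n := by exact_mod_cast hn
  have hu1 : (1 : ℝ) ≤ u := by exact_mod_cast hu
  obtain ⟨h1, h0⟩ := max_lt_iff.mp hwx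
  rw [sub_lt_iff_lt_add, div_lt_iff₀ (by linarith)] at h0
  have h2 : n * x < w * (x - n + 1) := by
    have h3 : (n - 1) * x / (x - n) * (x - n + 1) ≤ w * (x - n + 1) :=
      mul_le_mul_of_nonneg_right h1.le (by linarith)
    have h4 : n * x ≤ (n - 1) * x / (x - n) * (x - n + 1) := by
      rw [div_mul_eq_mul_div, le_div_iff₀ (by linarith)]
      nlinarith
    have h5 : (n - 1) * x / (x - n) * (x - n + 1) < w * (x - n + 1) :=
      mul_lt_mul_of_pos_right h1 (by linarith)
    linarith
  rw [div_lt_iff₀ (by linarith)] at h1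
  -- the strict inequalities persist for slightly smaller `x`
  have c0 : ContinuousAt (fun y : ℝ => (w + 1) * (y - n - u + 1) - n * (y + 1)) x := by fun_prop
  have c1 : ContinuousAt (fun y : ℝ => w * (y - n) - (n - 1) * y) x := by fun_prop
  have c2 : ContinuousAt (fun y : ℝ => w * (y - n + 1) - n * y) x := by fun_prop
  have e0 := c0.eventually (lt_mem_nhds (a := (0 : ℝ)) (by linarith))
  have e1 := c1.eventually (lt_mem_nhds (a := (0 : ℝ)) (by linarith))
  have e2 := c2.eventually (lt_mem_nhds (a := (0 : ℝ)) (by linarith))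
  obtain ⟨y, ⟨hy0, hy1, hy2⟩, hyx1, hyx2⟩ := (((e0.and (e1.and e2)).filter_mono
    nhdsWithin_le_nhds).and (Ioo_mem_nhdsLT hx)).exists
  have hy : 0 < y := by linarith
  exact false_of_irreducible_approx hn hyx1 hw (by linarith) (by linarith) (by linarith) hy
    (hQ y hy hyx2) hP

lemma sharpBound_nonneg {n u : ℕ} (hn : 1 ≤ n) (hu : 1 ≤ u) {x : ℝ} (hx : n + u - 1 < x) :
    0 ≤ sharpBound n u x := by
  have hn1 : (1 : ℝ) ≤ n := by exact_mod_cast hn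
  have hu1 : (1 : ℝ) ≤ u := by exact_mod_cast hu
  exact le_max_of_le_left (div_nonneg (mul_nonneg (by linarith) (by linarith)) (by linarith))

/-- Here the approximating polynomials `Q` are irreducible, so `P ∣ Q` means `Q = ±P`. -/
lemma wExp_le_sharpBound_of_wHatStar {ζ : ℝ} (hζ : Transcendental ℚ ζ) {n u : ℕ} (hn : 1 ≤ n)
    (hu : 1 ≤ u) {x : ℝ} (hx : n + u - 1 < x) (hstar : wHatStar n ζ = (x : EReal)) :
    wExp (n + u) ζ ≤ (sharpBound n u x : EReal) := by
  by_contra! hlt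
  obtain ⟨w, hw, hwE⟩ := EReal.lt_iff_exists_real_btwn.mp hlt
  rw [EReal.coe_lt_coe_iff] at hw
  have hw0 : 0 < w := (sharpBound_nonneg hn hu hx).trans_lt hw
  have hx2 : x ≤ 2 * n - 1 := by
    have := wHatStar_le hn hζ
    rwa [hstar, EReal.coe_le_coe_iff] at this
  refine wExp_le_sharpBound_of hn hu hx hx2 (adm := Irreducible) (fun y hy hyx =>
    uniformApprox_irreducible_of_lt_wHatStar hζ hy.le
      (by rw [hstar]; exact_mod_cast hyx)) hw0 hw fun H₀ => ?_
  obtain ⟨P, hP1, hP2, hP3, hP4⟩ := exists_irreducible_of_lt_wExp hζ hw0 hwE H₀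
  refine ⟨P, hP1, hP2, hP3, aeval_pos_of_transcendental hζ hP1.ne_zero, hP4,
    fun Q hQ0 hQ _ hdvd => ?_⟩
  exact abs_aeval_le_of_dvd_of_natDegree_le hQ0 hdvd
    (natDegree_le_of_dvd (hP1.dvd_symm hQ hdvd) hP1.ne_zero)

/-- If `w_{n-1}(ζ) < w_{n+u-1}(ζ)`, then the good approximations `P` of degree at most `n + u` have
degree at least `n`, so `P ∣ Q` means that `Q` is an integer multiple of `P`. -/
lemma wExp_le_sharpBound_of_wHat {ζ : ℝ} (hζ : Transcendental ℚ ζ) {n u : ℕ} (hn : 1 ≤ n)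
    (hu : 1 ≤ u) {x : ℝ} (hx : n + u - 1 < x) (hhat : wHat n ζ = (x : EReal))
    (hE : ExtraCond n u ζ) : wExp (n + u) ζ ≤ (sharpBound n u x : EReal) := by
  rcases hE with hE | hE
  swap
  · exact wExp_le_sharpBound_of_wHatStar hζ hn hu hx (hE ▸ hhat)
  by_contra! hlt
  obtain ⟨w, hw, hwE⟩ := EReal.lt_iff_exists_real_btwn.mp
    (max_lt hlt (hE.trans_le (wExp_mono (by omega) ζ)))
  rw [max_lt_iff, EReal.coe_lt_coe_iff] at hw
  have hw0 : 0 < w := (sharpBound_nonneg hn hu hx).trans_lt hw.1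
  have hx2 : x ≤ 2 * n - 1 := by
    have := wHat_le hn hζ
    rwa [hhat, EReal.coe_le_coe_iff] at this
  obtain ⟨H₁, hH₁⟩ := exists_forall_lt_natDegree_of_wExp_lt hζ hw.2
  refine wExp_le_sharpBound_of hn hu hx hx2 (adm := fun _ => True) (fun y hy hyx =>
    uniformApprox_of_lt_wHat (by rw [hhat]; exact_mod_cast hyx)) hw0 hw.1 fun H₀ => ?_
  obtain ⟨P, hP1, hP2, hP3, hP4⟩ := exists_irreducible_of_lt_wExp hζ hw0 hwE (max H₀ (H₁ + 1))
  have hdeg := hH₁ P hP1.ne_zero (by linarith [le_max_right H₀ (H₁ + 1)]) hP4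
  exact ⟨P, hP1, hP2, (le_max_left _ _).trans hP3, aeval_pos_of_transcendental hζ hP1.ne_zero, hP4,
    fun Q hQ0 _ hQn hdvd => abs_aeval_le_of_dvd_of_natDegree_le hQ0 hdvd (by omega)⟩

lemma sharpBound_le_boundFun {n u : ℕ} (hn : 1 ≤ n) (hu : 1 ≤ u) {x : ℝ} (hx : n + u - 1 < x) :
    sharpBound n u x ≤ boundFun n u x := by
  have hn1 : (1 : ℝ) ≤ n := by exact_mod_cast hn
  have hu1 : (1 : ℝ) ≤ u := by exact_mod_cast hu
  have hA : 0 < x - n := by linarith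
  have hB : 0 < x - n - u + 1 := by linarith
  have hW : 0 ≤ (n - 1) * x / (x - n) :=
    div_nonneg (mul_nonneg (by linarith) (by linarith)) hA.le
  have hF : boundFun n u x =
      (x + 1) * ((n - 1) * x / (x - n) + x - u + 1) / (x - n - u + 1) - 1 := by
    have hB' : x - n - u + 1 ≠ 0 := hB.ne'
    have hA' : x - n ≠ 0 := hA.ne'
    rw [boundFun]
    field_simp
    ring
  rw [hF, sharpBound]
  set W := (n - 1) * x / (x - n) with hWdef
  refine max_le ?_ ?_
  · rw [le_sub_iff_add_le, le_div_iff₀ hB]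
    nlinarith [mul_le_mul (show x - n - u + 1 ≤ x + 1 by linarith)
      (show W + 1 ≤ W + x - u + 1 by linarith) (by linarith) (by linarith)]
  · rw [mul_comm (n : ℝ)]
    gcongr
    · linarith
    · linarith

/-- A bound in terms of the excess `δ` of the uniform exponent over `n + u - 1`. -/
lemma sharpBound_le {n u : ℕ} (hn : 1 ≤ n) (hu : 1 ≤ u) {δ : ℝ} (hδ : 0 < δ)
    (hx2 : n + u - 1 + δ ≤ 2 * n - 1) :
    sharpBound n u (n + u - 1 + δ) ≤ 2 * n ^ 2 / δ := by
  have hn1 : (1 : ℝ) ≤ n := by exact_mod_cast hn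
  have hu1 : (1 : ℝ) ≤ u := by exact_mod_cast hu
  refine max_le ?_ ?_
  · refine div_le_div₀ (by positivity) ?_ hδ (by linarith)
    nlinarith [mul_le_mul (show (n : ℝ) - 1 ≤ n by linarith) hx2 (by linarith) (by linarith)]
  · have e : (n : ℝ) + u - 1 + δ - n - u + 1 = δ := by ring
    rw [e]
    refine (sub_le_self _ zero_le_one).trans ?_
    refine div_le_div_of_nonneg_right ?_ hδ.le
    nlinarith

end

theorem theorem4p3 :
    -- the explicit bounds
    (∀ (ζ : ℝ) (n u : ℕ), Transcendental ℚ ζ → 2 ≤ n → 1 ≤ u →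
      ((((n : ℝ) + u - 1 : ℝ) : EReal) < wHatStar n ζ →
        wHatStar n ζ ≠ ⊤ ∧
        wExp (n + u) ζ ≤ ((boundFun n u (wHatStar n ζ).toReal : ℝ) : EReal)) ∧
      ((((n : ℝ) + u - 1 : ℝ) : EReal) < wHat n ζ → ExtraCond n u ζ →
        wHat n ζ ≠ ⊤ ∧
        wExp (n + u) ζ ≤ ((boundFun n u (wHat n ζ).toReal : ℝ) : EReal))) ∧
    -- the asymptotic bounds, with absolute constants
    (∃ c c' : ℕ, 0 < c ∧ 0 < c' ∧
      ∀ (ζ : ℝ) (n u : ℕ), Transcendental ℚ ζ → 2 ≤ n → 1 ≤ u →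
      ∀ δ : ℝ, 0 < δ →
        (wHatStar n ζ = (((n : ℝ) + u - 1 + δ : ℝ) : EReal) ∨
          (wHat n ζ = (((n : ℝ) + u - 1 + δ : ℝ) : EReal) ∧ ExtraCond n u ζ)) →
        wExp (n + u) ζ ≤ ((c * (n : ℝ) ^ 3 / δ ^ 2 : ℝ) : EReal) ∧
        (2 ≤ u → wExp (n + 1) ζ ≤ ((c' * (n : ℝ) ^ 3 / δ : ℝ) : EReal))) := by
  refine ⟨fun ζ n u hζ hn hu => ⟨fun h => ?_, fun h hE => ?_⟩, 2, 2, two_pos, two_pos, ?_⟩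
  · have htop : wHatStar n ζ ≠ ⊤ :=
      ((wHatStar_le (by omega) hζ).trans_lt (EReal.coe_lt_top _)).ne
    refine ⟨htop, ?_⟩
    have hx := (EReal.coe_toReal htop ((bot_le.trans_lt h).ne')).symm
    rw [hx, EReal.coe_lt_coe_iff] at h
    exact (wExp_le_sharpBound_of_wHatStar hζ (by omega) hu h hx).trans
      (EReal.coe_le_coe_iff.mpr (sharpBound_le_boundFun (by omega) hu h))
  · have htop : wHat n ζ ≠ ⊤ := ((wHat_le (by omega) hζ).trans_lt (EReal.coe_lt_top _)).ne
    refine ⟨htop, ?_⟩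
    have hx := (EReal.coe_toReal htop ((bot_le.trans_lt h).ne')).symm
    rw [hx, EReal.coe_lt_coe_iff] at h
    exact (wExp_le_sharpBound_of_wHat hζ (by omega) hu h hx hE).trans
      (EReal.coe_le_coe_iff.mpr (sharpBound_le_boundFun (by omega) hu h))
  · intro ζ n u hζ hn hu δ hδ h
    have hn1 : 1 ≤ n := by omega
    have hx : (n : ℝ) + u - 1 < n + u - 1 + δ := by linarith
    obtain ⟨hw, hx2⟩ : wExp (n + u) ζ ≤ (sharpBound n u (n + u - 1 + δ) : EReal) ∧
        (n : ℝ) + u - 1 + δ ≤ 2 * n - 1 := by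
      rcases h with h | ⟨h, hE⟩
      · refine ⟨wExp_le_sharpBound_of_wHatStar hζ hn1 hu hx h, ?_⟩
        have := wHatStar_le hn1 hζ
        rwa [h, EReal.coe_le_coe_iff] at this
      · refine ⟨wExp_le_sharpBound_of_wHat hζ hn1 hu hx h hE, ?_⟩
        have := wHat_le hn1 hζ
        rwa [h, EReal.coe_le_coe_iff] at this
    have hb := sharpBound_le hn1 hu hδ hx2
    have hn1' : (1 : ℝ) ≤ n := by exact_mod_cast hn1
    have hu1 : (1 : ℝ) ≤ u := by exact_mod_cast hu
    -- since `n + 1 ≤ n + u`, the bound for `w_{n+u}` also serves for `w_{n+1}`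
    refine ⟨hw.trans (EReal.coe_le_coe_iff.mpr (hb.trans ?_)), fun _ =>
      (wExp_mono (by omega) ζ).trans (hw.trans (EReal.coe_le_coe_iff.mpr (hb.trans ?_)))⟩
    · -- here `δ ≤ n - u ≤ n`
      rw [div_le_div_iff₀ hδ (by positivity)]
      have : (2 * (n : ℝ) ^ 2 * δ) * δ ≤ (2 * (n : ℝ) ^ 2 * δ) * n := by gcongr; linarith
      push_cast
      linarith
    · push_cast
      gcongr
      omega
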